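/- **Conventions.** Let $H$ be a real separable Hilbert space and let $\Lambda$ be a topological space. *Families.* A *continuous family of Fredholm $C^2$ functionals* parametrized by $\Lambda$ consists of an open neighbourhood $U$ of $0$ in $H$ and functions $\psi_\lambda\colon U\to\mathbb{R}$ $(\lambda\in\Lambda)$ of class $C^2$ such that the maps $(\lambda,x)\mapsto d\psi_\lambda(x)$ and $(\lambda,x)\mapsto d^2\psi_\lambda(x)$ are continuous on $\Lambda\times U$ (for the norm topologies), $0$ is a critical point of every $\psi_\lambda$, and every Hessian $L_\lambda=D(\nabla\psi_\lambda)(0)$ is a Fredholm operator. Each $L_\lambda$ is then bounded and self-adjoint, and $\lambda\mapsto L_\lambda$ is norm continuous. *Spectral flow.* Let $M=(M_s)_{s\in[a,b]}$ be a norm-continuous path of bounded self-adjoint Fredholm operators on $H$. There are a subdivision $a=t_0\le t_1\le\dots\le t_N=b$ and numbers $\varepsilon_0,\dots,\varepsilon_{N-1}>0$ such that, for all $i$ and all $s\in[t_i,t_{i+1}]$, $\pm\varepsilon_i$ are not in the spectrum of $M_s$ and $M_s-\mu$ is Fredholm whenever $|\mu|\le\varepsilon_i$. The spectral flow of $M$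 is the integer $$\operatorname{sf}(M,[a,b])=\sum_{i=0}^{N-1}\Big(\dim E_{[0,\varepsilon_i]}(M_{t_{i+1}})-\dim E_{[0,\varepsilon_i]}(M_{t_i})\Big),$$ where $E_{[0,\varepsilon]}(T)$ is the (here finite-dimensional) sum of the eigenspaces of $T$ for the eigenvalues in $[0,\varepsilon]$; it does not depend on the choice of the subdivision and of the $\varepsilon_i$. *Assumption (A).* A path $\gamma\colon[a,b]\to\Lambda$ is *admissible* if it is continuous and $L_{\gamma(a)}$ and $L_{\gamma(b)}$ are invertible. The family satisfies (A) if for every admissible path $\gamma$ the spectral flow $\operatorname{sf}(L\circ\gamma,[a,b])$ depends only on the end points $\gamma(a)$ and $\gamma(b)$ or, equivalently, if $\operatorname{sf}(L\circ\gamma,[a,b])=0$ for every closed admissible path $\gamma$. **Proposition.** Let $\Lambda$ be a connected topological space of finite type, i.e. all singular homology groups $H_k(\Lambda;\mathbb{Z})$, $k\ge 0$, are finitely generated. If $H_1(\Lambda;\mathbb{Q})=0$, then every continuous family of Fredholm $C^2$ functionals parametrized by $\Lambda$ satisfies (A). -/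

import Mathlib

open Set AlgebraicTopology

universe u

noncomputable section

/-! ### Singular homology -/

/-- The `k`-th singular homology `H_k(X; A)` of a topological space `X` with coefficients in the
abelian group `A` (lifted to the universe of `X`), as a `ℤ`-module. -/
def singularHomology (k : ℕ) (X : Type u) [TopologicalSpace X] (A : Type)
    [AddCommGroup A] : ModuleCat.{u} ℤ :=
  ((singularHomologyFunctor (ModuleCat.{u} ℤ) k).obj (ModuleCat.of ℤ (ULift.{u} A))).obj (TopCat.of X)

/-- A space is of finite type if all its integral homology groups are finitely generated. -/
def IsOfFiniteType (X : Type*) [TopologicalSpace X] : Prop :=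
  ∀ k : ℕ, Module.Finite ℤ (singularHomology k X ℤ)

/-! ### Spectral flow of a path of self-adjoint Fredholm operators -/

section SpectralFlow

variable {H : Type*} [NormedAddCommGroup H] [InnerProductSpace ℝ H] [CompleteSpace H]

/-- `ε > 0` is a spectral window for `T`: neither `ε` nor `-ε` lies in the spectrum of `T`, and
`[-ε, ε]` does not meet the essential spectrum of `T`, i.e. `T - μ` is Fredholm for `|μ| ≤ ε`. For
self-adjoint `T` this says that the spectrum of `T` in `[-ε, ε]` consists of finitely many
eigenvalues of finite multiplicity, all of them in the open interval `(-ε, ε)`. -/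
structure IsSpectralWindow (T : H →L[ℝ] H) (ε : ℝ) : Prop where
  pos : 0 < ε
  right_notMem : ε ∉ spectrum ℝ T
  left_notMem : -ε ∉ spectrum ℝ T
  isFredholm : ∀ μ ∈ Icc (-ε) ε, (T - μ • ContinuousLinearMap.id ℝ H).IsFredholm

/-- The number of eigenvalues of `T` in `[0, ε]`, counted with multiplicity. If `T` is self-adjoint
and `ε` is a spectral window for `T`, this is the rank of the spectral projection
`1_[0,ε](T)`. -/
def eigenvalueCount (T : H →L[ℝ] H) (ε : ℝ) : ℕ :=
  Module.finrank ℝ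
    (⨆ μ ∈ Icc (0 : ℝ) ε, Module.End.eigenspace (T : H →ₗ[ℝ] H) μ : Submodule ℝ H)

/-- `n` is the value of the spectral flow of the path `L` on `[a, b]` computed by means of some
subdivision `a = t₀ ≤ t₁ ≤ … ≤ t_N = b` and numbers `ε₀, …, ε_{N-1}` such that `εᵢ` is a spectral
window for all the operators `L s`, `tᵢ ≤ s ≤ tᵢ₊₁`. -/
def IsSpectralFlowValue (L : ℝ → H →L[ℝ] H) (a b : ℝ) (n : ℤ) : Prop :=
  ∃ (N : ℕ) (t ε : ℕ → ℝ), Monotone t ∧ t 0 = a ∧ t N = b ∧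
    (∀ i < N, ∀ s ∈ Icc (t i) (t (i + 1)), IsSpectralWindow (L s) (ε i)) ∧
    n = ∑ i ∈ Finset.range N,
      ((eigenvalueCount (L (t (i + 1))) (ε i) : ℤ) - (eigenvalueCount (L (t i)) (ε i) : ℤ))

/-- The spectral flow of `L` on `[a, b]` is well defined and equal to `n`: some admitted choice of
subdivision and windows gives the value `n`, and no such choice gives another value. -/
def HasSpectralFlow (L : ℝ → H →L[ℝ] H) (a b : ℝ) (n : ℤ) : Prop :=
  ∀ m : ℤ, IsSpectralFlowValue L a b m ↔ m = n

end SpectralFlow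

/-! ### Continuous families of Fredholm `C²` functionals -/

section Families

variable {Λ : Type*} [TopologicalSpace Λ]
variable {H : Type*} [NormedAddCommGroup H] [InnerProductSpace ℝ H] [CompleteSpace H]

/-- The Hessian `L_l` at `0` of the functional `ψ l`: the derivative at `0` of its gradient. -/
def hessian (ψ : Λ → H → ℝ) (l : Λ) : H →L[ℝ] H :=
  fderiv ℝ (gradient (ψ l)) 0

/-- `ψ` is a continuous family of Fredholm `C²` functionals on the open neighbourhood `U` of `0`,
having `0` as critical point for all parameters. -/
structure IsFredholmC2Family (U : Set H) (ψ : Λ → H → ℝ) : Prop where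
  isOpen : IsOpen U
  zero_mem : (0 : H) ∈ U
  contDiffOn : ∀ l, ContDiffOn ℝ 2 (ψ l) U
  continuousOn_fderiv :
    ContinuousOn (fun p : Λ × H => fderiv ℝ (ψ p.1) p.2) (univ ×ˢ U)
  continuousOn_fderiv_fderiv :
    ContinuousOn (fun p : Λ × H => fderiv ℝ (fderiv ℝ (ψ p.1)) p.2) (univ ×ˢ U)
  critical : ∀ l, gradient (ψ l) 0 = 0
  isFredholm : ∀ l, (hessian ψ l).IsFredholm

/-- `γ : [a, b] → Λ` is an admissible path for the family `L` of operators: it is continuous and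
the operators at its end points are invertible. -/
structure IsAdmissiblePath (L : Λ → H →L[ℝ] H) (γ : ℝ → Λ) (a b : ℝ) : Prop where
  le : a ≤ b
  continuousOn : ContinuousOn γ (Icc a b)
  isUnit_left : IsUnit (L (γ a))
  isUnit_right : IsUnit (L (γ b))

/-- Assumption (A) for the family `L` of operators, in its two forms: the spectral flow along an
admissible path depends only on the end points of the path, and the spectral flow along every closed
admissible path vanishes. -/
structure SatisfiesA (L : Λ → H →L[ℝ] H) : Prop where
  endpoints : ∀ (γ₁ γ₂ : ℝ → Λ) (a b c d : ℝ),
    IsAdmissiblePath L γ₁ a b → IsAdmissiblePath L γ₂ c d → γ₁ a = γ₂ c → γ₁ b = γ₂ d →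
      ∃ n : ℤ, HasSpectralFlow (L ∘ γ₁) a b n ∧ HasSpectralFlow (L ∘ γ₂) c d n
  closed : ∀ (γ : ℝ → Λ) (a b : ℝ),
    IsAdmissiblePath L γ a b → γ a = γ b → HasSpectralFlow (L ∘ γ) a b 0

end Families

end

/-! For fixed `ε`, the parameters for which `ε` is a spectral window form an open set, and these
sets cover `Λ`. The number of eigenvalues in `[0, ε]` jumps when an eigenvalue crosses `0`, but for
`ε < ε'` the two counts differ by the number of eigenvalues in `[ε, ε']`, which is locally constant
where both windows are admitted (`IsSpectralInterval.eventually`). The counts thus form an integral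
local system (`isIntegralLocalSystem_eigenvalueCount`), that is, a principal `ℤ`-bundle over `Λ`.

Along a path the system has a primitive, and the spectral flow is its increment
(`hasSpectralFlow_of_isPrimitive`). Primitives also exist over singular simplices, so the increments
along 1-simplices form an integral singular cocycle. Two paths with the same end points differ by a
cycle, which bounds rationally when `H₁(Λ; ℚ) = 0`; hence the cocycle agrees on them
(`cocycle_eq_of_isZero_singularHomology`). -/

/-! ### Primitives of integral local systems -/

section LocalSystem

variable {X Y ι : Type*} [TopologicalSpace X] [TopologicalSpace Y]

/-- Integer valued functions `f i`, considered on the members `V i` of an open cover, any two of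
which differ by a locally constant function. -/
structure IsIntegralLocalSystem (V : ι → Set Y) (f : ι → Y → ℤ) : Prop where
  isOpen : ∀ i, IsOpen (V i)
  cover : ∀ y, ∃ i, y ∈ V i
  continuousOn_sub : ∀ i j, ContinuousOn (fun y => f i y - f j y) (V i ∩ V j)

/-- A primitive of a local system is a function that differs by a locally constant function from
every function of the system. -/
def IsPrimitive (V : ι → Set Y) (f : ι → Y → ℤ) (g : Y → ℤ) : Prop :=
  ∀ i, ContinuousOn (fun y => g y - f i y) (V i)

variable {V : ι → Set Y} {f : ι → Y → ℤ}

theorem IsIntegralLocalSystem.comap (h : IsIntegralLocalSystem V f) {p : X → Y}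
    (hp : Continuous p) : IsIntegralLocalSystem (fun i => p ⁻¹' V i) (fun i => f i ∘ p) where
  isOpen i := (h.isOpen i).preimage hp
  cover x := h.cover (p x)
  continuousOn_sub i j := (h.continuousOn_sub i j).comp hp.continuousOn fun _ hx => hx

theorem IsPrimitive.comap {g : Y → ℤ} (h : IsPrimitive V f g) {p : X → Y} (hp : Continuous p) :
    IsPrimitive (fun i => p ⁻¹' V i) (fun i => f i ∘ p) (g ∘ p) := fun i =>
  (h i).comp hp.continuousOn fun _ hx => hx

theorem IsPrimitive.sub_eq_of_isPreconnected {g : Y → ℤ} (h : IsPrimitive V f g) {i : ι} {s : Set Y}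
    (hs : IsPreconnected s) (hsV : s ⊆ V i) {x y : Y} (hx : x ∈ s) (hy : y ∈ s) :
    g y - g x = f i y - f i x := by
  have := hs.constant ((h i).mono hsV) hx hy
  linarith

theorem IsPrimitive.sub_eq [PreconnectedSpace Y] (hV : IsIntegralLocalSystem V f) {g g' : Y → ℤ}
    (h : IsPrimitive V f g) (h' : IsPrimitive V f g') (x y : Y) : g y - g x = g' y - g' x := by
  have hc : Continuous fun y => g y - g' y := by
    rw [continuous_iff_continuousAt]
    intro y
    obtain ⟨i, hi⟩ := hV.cover y
    have hn := (hV.isOpen i).mem_nhds hi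
    have := ((h i).continuousAt hn).sub ((h' i).continuousAt hn)
    simpa [Pi.sub_def] using this
  have := isPreconnected_univ.constant hc.continuousOn (mem_univ x) (mem_univ y)
  linarith

/-- The principal `ℤ`-bundle of local primitives of a local system. -/
noncomputable def IsIntegralLocalSystem.bundleCore (h : IsIntegralLocalSystem V f) :
    FiberBundleCore ι Y ℤ where
  baseSet := V
  isOpen_baseSet := h.isOpen
  indexAt y := (h.cover y).choose
  mem_baseSet_at y := (h.cover y).choose_spec
  -- The coordinate in chart `i` of a local primitive `g` is `g - f i`.
  coordChange i j y n := n + (f i y - f j y)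
  coordChange_self i y _ v := by simp
  continuousOn_coordChange i j := continuousOn_snd.add
    ((h.continuousOn_sub i j).comp continuousOn_fst fun _ hx => hx.1)
  coordChange_comp i j k y _ v := by ring

/-- Primitives are the continuous sections of a covering with fibre `ℤ`; over a simply connected
base the identity lifts to such a section. -/
theorem IsIntegralLocalSystem.exists_isPrimitive [SimplyConnectedSpace Y]
    [LocallyPathConnectedSpace Y] (h : IsIntegralLocalSystem V f) : ∃ g, IsPrimitive V f g := by
  let Z := h.bundleCore
  have hcov : IsCoveringMap (Bundle.TotalSpace.proj : Z.TotalSpace → Y) :=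
    FiberBundle.isCoveringMap
  obtain ⟨y₀⟩ : Nonempty Y := inferInstance
  obtain ⟨F, ⟨-, hF⟩, -⟩ := hcov.existsUnique_continuousMap_lifts (ContinuousMap.id Y) y₀
    (⟨y₀, (0 : ℤ)⟩ : Z.TotalSpace) rfl
  have hF' : ∀ y, (F y).proj = y := fun y => congrFun hF y
  let v : Y → ℤ := fun y => (F y).snd
  refine ⟨fun y => v y + f (Z.indexAt y) y, fun i => ?_⟩
  have h1 : ContinuousOn (fun y => (Z.localTriv i (F y)).2) (V i) := by
    refine continuous_snd.comp_continuousOn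
      ((Z.localTriv i).continuousOn.comp F.continuous.continuousOn fun y hy => ?_)
    rw [Z.mem_localTriv_source, hF']
    exact hy
  refine h1.congr fun y hy => ?_
  change v y + f (Z.indexAt y) y - f i y =
    v y + (f (Z.indexAt (F y).proj) (F y).proj - f i (F y).proj)
  rw [hF']
  ring

end LocalSystem

/-! ### Integral cocycles on spaces with vanishing first rational homology -/

section Cocycle

open CategoryTheory Simplicial

/-- A face of a singular simplex. -/
noncomputable def ContinuousMap.simplexFace {X : Type*} [TopologicalSpace X] {n : ℕ}
    (σ : C(stdSimplex ℝ (Fin (n + 2)), X)) (i : Fin (n + 2)) : C(stdSimplex ℝ (Fin (n + 1)), X) :=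
  σ.comp ⟨stdSimplex.map i.succAbove, stdSimplex.continuous_map _⟩

/-- Extended linearly to rational chains, `c` kills boundaries. The cycle `σ - τ` is one by
exactness, so `c σ = c τ` in `ℚ`, hence in `ℤ`. -/
theorem cocycle_eq_of_isZero_singularHomology {X : Type u} [TopologicalSpace X]
    (hX : Limits.IsZero (singularHomology 1 X ℚ)) (c : C(stdSimplex ℝ (Fin 2), X) → ℤ)
    (hc : ∀ σ : C(stdSimplex ℝ (Fin 3), X),
      c (σ.simplexFace 0) - c (σ.simplexFace 1) + c (σ.simplexFace 2) = 0)
    (σ τ : C(stdSimplex ℝ (Fin 2), X))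
    (h : ∀ i, σ (stdSimplex.vertex i) = τ (stdSimplex.vertex i)) : c σ = c τ := by
  let S := TopCat.toSSet.obj (TopCat.of X)
  let R : ModuleCat.{u} ℤ := ModuleCat.of ℤ (ULift.{u} ℚ)
  let K := S.chainComplex R
  let e (n : ℕ) : S _⦋n⦌ ≃ C(stdSimplex ℝ (Fin (n + 1)), X) := TopCat.toSSetObjEquiv _ _
  have he (n : ℕ) (i : Fin (n + 2)) (x : S _⦋n + 1⦌) :
      e n (S.δ i x) = (e (n + 1) x).simplexFace i := rfl
  have hK : K.ExactAt 1 := (K.exactAt_iff_isZero_homology 1).2 hX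
  rw [K.exactAt_iff' 2 1 0 (by simp) (by simp), ShortComplex.moduleCat_exact_iff] at hK
  let φ : K.X 1 ⟶ R := Limits.Sigma.desc fun s : S _⦋1⦌ => c (e 1 s) • 𝟙 R
  have hι (s : S _⦋1⦌) : S.ιChainComplex s ≫ φ = c (e 1 s) • 𝟙 R := Limits.Sigma.ι_desc _ _
  have hdφ : K.d 2 1 ≫ φ = 0 := by
    refine SSet.chainComplex_hom_ext fun x => ?_
    have h3 := hc (e 2 x)
    have hd : S.ιChainComplex (R := R) x ≫ K.d 2 1 = S.ιChainComplex (S.δ 0 x) -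
        S.ιChainComplex (S.δ 1 x) + S.ιChainComplex (S.δ 2 x) := by
      refine (S.ιChainComplex_d R x).trans ((Fin.sum_univ_three _).trans ?_)
      simp [sub_eq_add_neg]
    have hsum : S.ιChainComplex (R := R) x ≫ K.d 2 1 ≫ φ =
        (c ((e 2 x).simplexFace 0) - c ((e 2 x).simplexFace 1) + c ((e 2 x).simplexFace 2)) •
          𝟙 R := by
      rw [← Category.assoc, hd, Preadditive.add_comp, Preadditive.sub_comp, hι, hι, hι, he, he, he,
        add_smul, sub_smul]
    rw [hsum, hc, zero_smul, Limits.comp_zero]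
  let s := (e 1).symm σ
  let t := (e 1).symm τ
  have hface (i : Fin 2) : S.δ i s = S.δ i t := by
    apply (e 0).injective
    rw [he, he]
    simp only [s, t, Equiv.apply_symm_apply]
    ext x : 1
    obtain rfl : x = stdSimplex.vertex 0 := Subsingleton.elim _ _
    change σ (stdSimplex.map _ _) = τ (stdSimplex.map _ _)
    rw [stdSimplex.map_vertex]
    exact h _
  have hcyc : (S.ιChainComplex s - S.ιChainComplex t : R ⟶ K.X 1) ≫ K.d 1 0 = 0 := by
    rw [Preadditive.sub_comp, SSet.ιChainComplex_d, SSet.ιChainComplex_d]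
    simp only [hface, sub_self]
  let one : R := ULift.up (1 : ℚ)
  obtain ⟨y, hy⟩ := hK ((S.ιChainComplex s - S.ιChainComplex t : R ⟶ K.X 1) one) (by
    exact congr($hcyc one))
  have h1 : φ ((S.ιChainComplex s - S.ιChainComplex t : R ⟶ K.X 1) one) = 0 := by
    rw [← hy]
    exact congr($hdφ y)
  have h2 : ((c σ - c τ) • 𝟙 R : R ⟶ R) one = 0 := by
    rw [← h1]
    have : (S.ιChainComplex s - S.ιChainComplex t : R ⟶ K.X 1) ≫ φ = (c σ - c τ) • 𝟙 R := by
      rw [Preadditive.sub_comp, hι, hι, sub_smul]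
      simp [s, t]
    rw [← this]
    rfl
  have h3 : (c σ - c τ) • (1 : ℚ) = 0 := congrArg ULift.down h2
  simpa [sub_eq_zero] using h3

end Cocycle

/-- Increments of primitives along 1-simplices do not depend on the primitive. They satisfy the
cocycle identity because one primitive over the whole triangle restricts to its three edges. -/
theorem IsIntegralLocalSystem.sub_eq_sub_of_isZero_singularHomology {X : Type u}
    [TopologicalSpace X] {ι : Type*} {V : ι → Set X} {f : ι → X → ℤ}
    (h : IsIntegralLocalSystem V f)
    (hX : CategoryTheory.Limits.IsZero (singularHomology 1 X ℚ))
    {p q : ℝ → X} (hp : Continuous p) (hq : Continuous q) {g g' : ℝ → ℤ}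
    (hg : IsPrimitive (fun i => p ⁻¹' V i) (fun i => f i ∘ p) g)
    (hg' : IsPrimitive (fun i => q ⁻¹' V i) (fun i => f i ∘ q) g')
    {a b c d : ℝ} (h₀ : p a = q c) (h₁ : p b = q d) : g b - g a = g' d - g' c := by
  have hex {n : ℕ} (σ : C(stdSimplex ℝ (Fin (n + 1)), X)) :
      ∃ g, IsPrimitive (fun i => σ ⁻¹' V i) (fun i => f i ∘ σ) g := by
    have : ContractibleSpace (stdSimplex ℝ (Fin (n + 1))) :=
      (convex_stdSimplex ℝ _).contractibleSpace ⟨_, (stdSimplex.vertex 0).2⟩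
    have : LocallyPathConnectedSpace (stdSimplex ℝ (Fin (n + 1))) :=
      (convex_stdSimplex ℝ _).locallyPathConnectedSpace
    exact (h.comap σ.continuous).exists_isPrimitive
  choose G hG using fun σ : C(stdSimplex ℝ (Fin 2), X) => hex σ
  let cochain (σ : C(stdSimplex ℝ (Fin 2), X)) : ℤ :=
    G σ (stdSimplex.vertex 1) - G σ (stdSimplex.vertex 0)
  have hcochain (σ : C(stdSimplex ℝ (Fin 2), X)) {g}
      (hg : IsPrimitive (fun i => σ ⁻¹' V i) (fun i => f i ∘ σ) g) :
      cochain σ = g (stdSimplex.vertex 1) - g (stdSimplex.vertex 0) :=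
    (hG σ).sub_eq (h.comap σ.continuous) hg _ _
  have hcocycle (σ : C(stdSimplex ℝ (Fin 3), X)) :
      cochain (σ.simplexFace 0) - cochain (σ.simplexFace 1) + cochain (σ.simplexFace 2) = 0 := by
    obtain ⟨g, hg⟩ := hex σ
    have hface (i : Fin 3) : cochain (σ.simplexFace i) =
        g (stdSimplex.vertex (i.succAbove 1)) - g (stdSimplex.vertex (i.succAbove 0)) := by
      rw [hcochain _ (hg.comap (stdSimplex.continuous_map i.succAbove))]
      simp only [Function.comp_apply, stdSimplex.map_vertex]
    rw [hface, hface, hface]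
    simp [Fin.succAbove, Fin.lt_def]
  let r (a b : ℝ) : C(stdSimplex ℝ (Fin 2), ℝ) :=
    ⟨fun x => a + x.1 1 * (b - a), continuous_const.add
      (((continuous_apply (1 : Fin 2)).comp continuous_subtype_val).mul continuous_const)⟩
  have hr₀ (a b : ℝ) : r a b (stdSimplex.vertex 0) = a := by simp [r, stdSimplex.vertex]
  have hr₁ (a b : ℝ) : r a b (stdSimplex.vertex 1) = b := by simp [r, stdSimplex.vertex]
  have key := cocycle_eq_of_isZero_singularHomology hX cochain hcocycle
    (ContinuousMap.comp ⟨p, hp⟩ (r a b)) (ContinuousMap.comp ⟨q, hq⟩ (r c d)) (by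
      rw [Fin.forall_fin_two]
      simp [hr₀, hr₁, h₀, h₁])
  rw [hcochain _ (hg.comap (r a b).continuous), hcochain _ (hg'.comap (r c d).continuous)] at key
  simpa [hr₀, hr₁] using key

/-! ### Spectral flow as the increment of a primitive. -/

section SpectralFlow

variable {H : Type*} [NormedAddCommGroup H] [InnerProductSpace ℝ H]

/-- On each subinterval one window is available throughout, so connectedness turns the change of the
count into the change of `g`, and the sum telescopes. This holds for every admitted choice;
compactness provides one. `M` is an extension of the path to all of `ℝ`. -/
theorem hasSpectralFlow_of_isPrimitive {L M : ℝ → H →L[ℝ] H} {a b : ℝ} (hab : a ≤ b)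
    (hLM : EqOn L M (Icc a b)) {g : ℝ → ℤ}
    (hV : IsIntegralLocalSystem (fun ε => {s | IsSpectralWindow (M s) ε})
      (fun ε s => (eigenvalueCount (M s) ε : ℤ)))
    (hg : IsPrimitive (fun ε => {s | IsSpectralWindow (M s) ε})
      (fun ε s => (eigenvalueCount (M s) ε : ℤ)) g) :
    HasSpectralFlow L a b (g b - g a) := by
  have value {n : ℤ} {N : ℕ} {t ε : ℕ → ℝ} (ht : Monotone t) (h₀ : t 0 = a) (hN : t N = b)
      (hwin : ∀ i < N, ∀ s ∈ Icc (t i) (t (i + 1)), IsSpectralWindow (L s) (ε i))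
      (hn : n = ∑ i ∈ Finset.range N, ((eigenvalueCount (L (t (i + 1))) (ε i) : ℤ) -
        (eigenvalueCount (L (t i)) (ε i) : ℤ))) : n = g b - g a := by
    have hmem {i : ℕ} (hi : i ≤ N) : t i ∈ Icc a b :=
      ⟨h₀ ▸ ht (Nat.zero_le i), hN ▸ ht hi⟩
    rw [hn, ← h₀, ← hN, ← Finset.sum_range_sub (fun i => g (t i))]
    refine Finset.sum_congr rfl fun i hi => ?_
    rw [Finset.mem_range] at hi
    have hle := ht (Nat.le_succ i)
    have hsub : Icc (t i) (t (i + 1)) ⊆ {s | IsSpectralWindow (M s) (ε i)} := fun s hs => by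
      rw [mem_ofPred_eq, ← hLM ⟨(hmem hi.le).1.trans hs.1, hs.2.trans (hmem hi).2⟩]
      exact hwin i hi s hs
    rw [hLM (hmem hi), hLM (hmem hi.le)]
    exact (hg.sub_eq_of_isPreconnected isPreconnected_Icc hsub
      (left_mem_Icc.2 hle) (right_mem_Icc.2 hle)).symm
  intro m
  constructor
  · rintro ⟨N, t, ε, ht, h₀, hN, hwin, hm⟩
    exact value ht h₀ hN hwin hm
  · rintro rfl
    obtain ⟨t, h₀, ht, ⟨N, hN⟩, hwin⟩ := exists_monotone_Icc_subset_open_cover_Icc hab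
      (c := fun ε : ℝ => Subtype.val ⁻¹' {s | IsSpectralWindow (M s) ε})
      (fun ε => (hV.isOpen ε).preimage continuous_subtype_val)
      (fun s _ => mem_iUnion.2 (hV.cover s))
    choose ε hε using hwin
    have hwin : ∀ i < N, ∀ s ∈ Icc (t i : ℝ) (t (i + 1)), IsSpectralWindow (L s) (ε i) := by
      intro i _ s hs
      have hs' : s ∈ Icc a b := ⟨(t i).2.1.trans hs.1, hs.2.trans (t (i + 1)).2.2⟩
      rw [hLM hs']
      exact hε i (show (⟨s, hs'⟩ : Icc a b) ∈ _ from ⟨hs.1, hs.2⟩)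
    have ht' : Monotone fun i => (t i : ℝ) := fun i j hij => ht hij
    exact ⟨N, fun i => t i, ε, ht', h₀, hN N le_rfl, hwin,
      (value ht' h₀ (hN N le_rfl) hwin rfl).symm⟩

end SpectralFlow

/-- If the eigenvalue counts in the spectral windows form a local system and the first rational
homology of the parameter space vanishes, then the spectral flow depends on the end points only. -/
theorem satisfiesA_of_isIntegralLocalSystem {Λ : Type*} [TopologicalSpace Λ]
    (hΛ : CategoryTheory.Limits.IsZero (singularHomology 1 Λ ℚ))
    {H : Type*} [NormedAddCommGroup H] [InnerProductSpace ℝ H] [CompleteSpace H]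
    {L : Λ → H →L[ℝ] H}
    (hV : IsIntegralLocalSystem (fun ε => {l | IsSpectralWindow (L l) ε})
      (fun ε l => (eigenvalueCount (L l) ε : ℤ))) : SatisfiesA L := by
  have flow {γ₁ γ₂ : ℝ → Λ} {a b c d : ℝ} (h₁ : IsAdmissiblePath L γ₁ a b)
      (h₂ : IsAdmissiblePath L γ₂ c d) (h₀ : γ₁ a = γ₂ c) (h₁' : γ₁ b = γ₂ d) :
      ∃ n : ℤ, HasSpectralFlow (L ∘ γ₁) a b n ∧ HasSpectralFlow (L ∘ γ₂) c d n := by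
    -- Extending the paths by constants makes them continuous on the simply connected space `ℝ`,
    -- where primitives exist.
    let p : ℝ → Λ := IccExtend h₁.le (domRestrict (Icc a b) γ₁)
    let q : ℝ → Λ := IccExtend h₂.le (domRestrict (Icc c d) γ₂)
    have hp : Continuous p := h₁.continuousOn.domRestrict.Icc_extend'
    have hq : Continuous q := h₂.continuousOn.domRestrict.Icc_extend'
    have hpγ : EqOn γ₁ p (Icc a b) := fun s hs => (IccExtend_of_mem h₁.le (domRestrict (Icc a b) γ₁) hs).symm
    have hqγ : EqOn γ₂ q (Icc c d) := fun s hs => (IccExtend_of_mem h₂.le (domRestrict (Icc c d) γ₂) hs).symm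
    obtain ⟨g, hg⟩ := (hV.comap hp).exists_isPrimitive
    obtain ⟨g', hg'⟩ := (hV.comap hq).exists_isPrimitive
    have heq := hV.sub_eq_sub_of_isZero_singularHomology hΛ hp hq hg hg'
      (a := a) (b := b) (c := c) (d := d)
      (by rw [← hpγ (left_mem_Icc.2 h₁.le), ← hqγ (left_mem_Icc.2 h₂.le), h₀])
      (by rw [← hpγ (right_mem_Icc.2 h₁.le), ← hqγ (right_mem_Icc.2 h₂.le), h₁'])
    refine ⟨g b - g a, hasSpectralFlow_of_isPrimitive h₁.le (M := L ∘ p) (hpγ.comp_left)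
      (hV.comap hp) hg, ?_⟩
    rw [heq]
    exact hasSpectralFlow_of_isPrimitive h₂.le (M := L ∘ q) (hqγ.comp_left) (hV.comap hq) hg'
  refine ⟨fun γ₁ γ₂ a b c d => flow, fun γ a b hγ hab => ?_⟩
  -- A closed path is compared with the constant path on `[a, a]`, whose flow is `0` by the empty
  -- subdivision `N = 0`.
  have hconst : IsAdmissiblePath L (fun _ => γ a) a a :=
    ⟨le_rfl, continuousOn_const, hγ.isUnit_left, hγ.isUnit_left⟩
  obtain ⟨n, hn, hn'⟩ := flow hγ hconst rfl hab.symm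
  obtain rfl : 0 = n := (hn' 0).1
    ⟨0, fun _ => a, fun _ => 1, monotone_const, rfl, rfl, by simp, by simp⟩
  exact hn

/-! ### Symmetric Fredholm operators and lower bounds. -/

section SymmetricOperators

open Module

variable {H : Type*} [NormedAddCommGroup H] [InnerProductSpace ℝ H]

theorem ContinuousLinearMap.isSymmetric_sub_smul_id {T : H →L[ℝ] H}
    (hT : (T : H →ₗ[ℝ] H).IsSymmetric) (μ : ℝ) :
    ((T - μ • ContinuousLinearMap.id ℝ H : H →L[ℝ] H) : H →ₗ[ℝ] H).IsSymmetric := fun x y => by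
  have := hT x y
  simp only [coe_coe] at this
  simp [inner_sub_left, inner_sub_right, inner_smul_left, inner_smul_right, this]

theorem ContinuousLinearMap.eigenspace_eq_ker (T : H →L[ℝ] H) (μ : ℝ) :
    End.eigenspace (T : H →ₗ[ℝ] H) μ = (T - μ • ContinuousLinearMap.id ℝ H).ker := by
  ext x
  simp [sub_eq_zero]

/-- A bound below of `T - μ` on a submodule, from one of `T`. -/
theorem ContinuousLinearMap.bound_sub_smul_id {T : H →L[ℝ] H} {c : ℝ} {x : H}
    (h : c * ‖x‖ ≤ ‖T x‖) (μ : ℝ) :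
    (c - |μ|) * ‖x‖ ≤ ‖(T - μ • ContinuousLinearMap.id ℝ H) x‖ := by
  have h1 : ‖T x‖ - ‖μ • x‖ ≤ ‖T x - μ • x‖ := norm_sub_norm_le _ _
  rw [norm_smul, Real.norm_eq_abs] at h1
  simp only [FunLike.coe_sub, FunLike.coe_smul, coe_id', Pi.sub_apply, Pi.smul_apply, id_eq]
  linarith

variable [CompleteSpace H]

/-- A symmetric operator that is bounded below on a subspace of finite codimension is Fredholm. -/
theorem ContinuousLinearMap.isFredholm_of_bound_orthogonal {T : H →L[ℝ] H}
    (hT : (T : H →ₗ[ℝ] H).IsSymmetric) (F : Submodule ℝ H) [FiniteDimensional ℝ F] {c : ℝ}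
    (hc : 0 < c) (h : ∀ x ∈ Fᗮ, c * ‖x‖ ≤ ‖T x‖) : T.IsFredholm := by
  have hF : Fᗮ.CoFG := (Submodule.fg_iff_finiteDimensional F |>.2 ‹_›).cofg_of_isCompl
    F.isCompl_orthogonal
  have hanti : AntilipschitzWith (Real.toNNReal c⁻¹) (T.domRestrict Fᗮ) := by
    refine ContinuousLinearMap.antilipschitz_of_bound _ fun x => ?_
    rw [Real.coe_toNNReal _ (by positivity), inv_mul_eq_div, le_div_iff₀ hc, mul_comm]
    exact h x x.2
  have hemb := hanti.isClosedEmbedding (T.domRestrict Fᗮ).uniformContinuous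
  obtain ⟨hstrict, hclosed⟩ := (T.isStrictMap_isClosed_range_iff_restrict Fᗮ
    F.isClosed_orthogonal).2 ⟨hemb.isEmbedding.isStrictMap, by
      rw [LinearMap.coe_range]; exact hemb.isClosed_range⟩
  have hdisj : Disjoint Fᗮ T.ker := by
    rw [Submodule.disjoint_def]
    intro x hx hx'
    have h1 := h x hx
    rw [show T x = 0 from hx', norm_zero] at h1
    exact norm_le_zero_iff.1 (nonpos_of_mul_nonpos_right h1 hc)
  have hker : FiniteDimensional ℝ T.ker :=
    (Submodule.fg_iff_finiteDimensional _).1 (hF.fg_of_disjoint hdisj.symm)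
  -- By symmetry, finiteness of the kernel gives finiteness of the cokernel.
  have hort : T.rangeᗮ = T.ker := hT.orthogonal_range
  refine ⟨hstrict, hclosed, hker, ?_, .of_disjoint_of_finiteDimensional_quotient
    F.isClosed_orthogonal hdisj.symm⟩
  have : CompleteSpace T.range := hclosed.completeSpace_coe
  have h1 : T.rangeᗮ.FG := by rw [hort]; exact (Submodule.fg_iff_finiteDimensional _).2 hker
  exact h1.cofg_of_isCompl T.range.isCompl_orthogonal.symm

/-- Restricted to the complement of its kernel, `T` is injective with the same closed range, so the
open mapping theorem applies. -/
theorem ContinuousLinearMap.IsFredholm.exists_bound_orthogonal_ker {T : H →L[ℝ] H}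
    (h : T.IsFredholm) : ∃ c > 0, ∀ x ∈ T.kerᗮ, c * ‖x‖ ≤ ‖T x‖ := by
  have := h.finite_ker
  have hinj : Function.Injective (T.domRestrict T.kerᗮ) := by
    rw [injective_iff_map_eq_zero]
    rintro ⟨x, hx⟩ hx'
    have := (Submodule.disjoint_def.1 T.ker.orthogonal_disjoint) x hx' hx
    simpa using this
  have hrange : Set.range (T.domRestrict T.kerᗮ) = (T.range : Set H) := by
    ext y
    constructor
    · rintro ⟨x, rfl⟩
      exact ⟨x, rfl⟩
    · rintro ⟨x, rfl⟩
      obtain ⟨k, hk, z, hz, rfl⟩ := Submodule.exists_add_mem_mem_orthogonal (K := T.ker) x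
      refine ⟨⟨z, hz⟩, ?_⟩
      simp [show T k = 0 from hk]
  obtain ⟨K, hK⟩ := (T.domRestrict T.kerᗮ).antilipschitz_of_injective_of_isClosed_range hinj
    (hrange ▸ h.isClosed_range)
  refine ⟨(K + 1)⁻¹, by positivity, fun x hx => ?_⟩
  rw [inv_mul_le_iff₀ (by positivity)]
  have h1 : ‖x‖ ≤ K * ‖T x‖ := ContinuousLinearMap.bound_of_antilipschitz _ hK ⟨x, hx⟩
  nlinarith [norm_nonneg (T x)]

theorem ContinuousLinearMap.IsFredholm.isUnit {T : H →L[ℝ] H} (h : T.IsFredholm)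
    (hT : (T : H →ₗ[ℝ] H).IsSymmetric) (hker : ∀ x, T x = 0 → x = 0) : IsUnit T := by
  rw [ContinuousLinearMap.isUnit_iff_bijective]
  refine ⟨(injective_iff_map_eq_zero T).2 hker, ?_⟩
  have : CompleteSpace T.range := h.isClosed_range.completeSpace_coe
  refine LinearMap.range_eq_top.1 (Submodule.orthogonal_eq_bot_iff.1 ?_)
  exact hT.orthogonal_range.trans (LinearMap.ker_eq_bot'.2 hker)

end SymmetricOperators

/-! ### Sums of eigenspaces and bounds on invariant subspaces. -/

section SpectralSubspace

open Module

variable {H : Type*} [NormedAddCommGroup H] [InnerProductSpace ℝ H]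

/-- The sum of the eigenspaces of `T` for the eigenvalues in `s`. -/
def spectralSubspace (T : H →L[ℝ] H) (s : Set ℝ) : Submodule ℝ H :=
  ⨆ μ ∈ s, End.eigenspace (T : H →ₗ[ℝ] H) μ

variable {T : H →L[ℝ] H} {s t : Set ℝ}

theorem eigenspace_le_spectralSubspace {μ : ℝ} (hμ : μ ∈ s) :
    End.eigenspace (T : H →ₗ[ℝ] H) μ ≤ spectralSubspace T s :=
  le_iSup₂_of_le μ hμ le_rfl

theorem spectralSubspace_mono (h : s ⊆ t) : spectralSubspace T s ≤ spectralSubspace T t :=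
  biSup_mono h

theorem spectralSubspace_union :
    spectralSubspace T (s ∪ t) = spectralSubspace T s ⊔ spectralSubspace T t :=
  iSup_union

theorem spectralSubspace_isOrtho (hT : (T : H →ₗ[ℝ] H).IsSymmetric) (hst : Disjoint s t) :
    spectralSubspace T s ⟂ spectralSubspace T t := by
  simp only [spectralSubspace, Submodule.isOrtho_iSup_left, Submodule.isOrtho_iSup_right]
  intro μ hμ ν hν
  have hne : ν ≠ μ := hst.ne_of_mem hν hμ
  exact Submodule.isOrtho_iff_inner_eq.2 fun x hx y hy =>
    hT.orthogonalFamily_eigenspaces hne ⟨x, hx⟩ ⟨y, hy⟩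

theorem finrank_spectralSubspace_union (hT : (T : H →ₗ[ℝ] H).IsSymmetric) (hst : Disjoint s t)
    [FiniteDimensional ℝ (spectralSubspace T s)] [FiniteDimensional ℝ (spectralSubspace T t)] :
    finrank ℝ (spectralSubspace T (s ∪ t)) =
      finrank ℝ (spectralSubspace T s) + finrank ℝ (spectralSubspace T t) := by
  rw [spectralSubspace_union, ← Submodule.finrank_sup_add_finrank_inf_eq,
    (spectralSubspace_isOrtho hT hst).disjoint.eq_bot, finrank_bot, add_zero]

theorem apply_mem_orthogonal_spectralSubspace (hT : (T : H →ₗ[ℝ] H).IsSymmetric) {x : H}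
    (hx : x ∈ (spectralSubspace T s)ᗮ) : T x ∈ (spectralSubspace T s)ᗮ := by
  have hinv : spectralSubspace T s ≤ (spectralSubspace T s).comap (T : H →ₗ[ℝ] H) :=
    iSup₂_le fun μ hμ y hy => by
      rw [Submodule.mem_comap, End.mem_eigenspace_iff.1 hy]
      exact Submodule.smul_mem _ _ (eigenspace_le_spectralSubspace hμ hy)
  rw [Submodule.mem_orthogonal] at hx ⊢
  exact fun y hy => (hT y x).symm.trans (hx _ (hinv hy))

/-- Pythagoras for a finite sum of orthogonal eigenvectors. Only actual eigenvalues in `s` are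
constrained, so `ρ` may be smaller than the radius of `s`. -/
theorem norm_sub_smul_id_le_of_mem_spectralSubspace (hT : (T : H →ₗ[ℝ] H).IsSymmetric) {m ρ : ℝ}
    (hρ : 0 ≤ ρ) (hs : ∀ μ ∈ s, (∃ x, x ≠ 0 ∧ T x = μ • x) → |μ - m| ≤ ρ) {x : H}
    (hx : x ∈ spectralSubspace T s) :
    ‖(T - m • ContinuousLinearMap.id ℝ H) x‖ ≤ ρ * ‖x‖ := by
  rw [spectralSubspace, Submodule.mem_iSup_iff_exists_finsupp] at hx
  obtain ⟨f, hf, rfl⟩ := hx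
  have hmem : ∀ μ, f μ ∈ End.eigenspace (T : H →ₗ[ℝ] H) μ := fun μ =>
    (iSup_le (fun _ => le_rfl) : (⨆ _ : μ ∈ s, End.eigenspace (T : H →ₗ[ℝ] H) μ) ≤ _) (hf μ)
  have hfT : ∀ μ, T (f μ) = μ • f μ := fun μ => by simpa using hmem μ
  have hbound : ∀ μ ∈ f.support, |μ - m| ≤ ρ := by
    intro μ hμ
    have hμ0 : f μ ≠ 0 := Finsupp.mem_support_iff.1 hμ
    refine hs μ ?_ ⟨f μ, hμ0, hfT μ⟩
    by_contra hns
    have := hf μ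
    simp only [hns, iSup_false, Submodule.mem_bot] at this
    exact hμ0 this
  have hort := hT.orthogonalFamily_eigenspaces
  have h1 : ‖f.sum fun _ v => v‖ ^ 2 = ∑ μ ∈ f.support, ‖f μ‖ ^ 2 :=
    hort.norm_sum (fun μ => ⟨f μ, hmem μ⟩) f.support
  have h2 : ‖(T - m • ContinuousLinearMap.id ℝ H) (f.sum fun _ v => v)‖ ^ 2 =
      ∑ μ ∈ f.support, ‖(μ - m) • f μ‖ ^ 2 := by
    rw [← show _ = ∑ μ ∈ f.support, ‖(μ - m) • f μ‖ ^ 2 from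
      hort.norm_sum (fun μ => ⟨(μ - m) • f μ, Submodule.smul_mem _ _ (hmem μ)⟩) f.support]
    rw [Finsupp.sum, map_sum]
    congr 2
    refine Finset.sum_congr rfl fun μ _ => ?_
    simp [hfT, sub_smul]
  refine le_of_sq_le_sq ?_ (by positivity)
  rw [h2, mul_pow, h1, Finset.mul_sum]
  refine Finset.sum_le_sum fun μ hμ => ?_
  rw [norm_smul, mul_pow, Real.norm_eq_abs]
  gcongr
  exact hbound μ hμ

/-- If `B` is symmetric and `B ± d` are bounded below on an invariant subspace on which `B` is
bounded below by `d`, then the lower bound `d` can be improved. -/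
theorem exists_lt_bound_of_bound_sub_of_bound_add {B : H →L[ℝ] H}
    (hB : (B : H →ₗ[ℝ] H).IsSymmetric) {F : Submodule ℝ H} (hF : ∀ x ∈ F, B x ∈ F) {d : ℝ}
    (hd : 0 ≤ d) (hBd : ∀ x ∈ F, d * ‖x‖ ≤ ‖B x‖) {c₁ c₂ : ℝ} (hc₁ : 0 < c₁) (hc₂ : 0 < c₂)
    (h₁ : ∀ x ∈ F, c₁ * ‖x‖ ≤ ‖B x - d • x‖) (h₂ : ∀ x ∈ F, c₂ * ‖x‖ ≤ ‖B x + d • x‖) :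
    ∃ d' > d, ∀ x ∈ F, d' * ‖x‖ ≤ ‖B x‖ := by
  -- `A = (B - d)(B + d)` is bounded below on `F`, and its quadratic form is nonnegative there. The
  -- two together make the form coercive, without functional calculus.
  let A : H →L[ℝ] H := B ∘L B - (d ^ 2) • ContinuousLinearMap.id ℝ H
  have hA (x : H) : A x = B (B x) - d ^ 2 • x := by simp [A]
  have hsym (x y : H) : inner ℝ (B x) y = inner ℝ x (B y) := hB x y
  have hform (x : H) : inner ℝ (A x) x = ‖B x‖ ^ 2 - d ^ 2 * ‖x‖ ^ 2 := by
    rw [hA, inner_sub_left, hsym, inner_smul_left, real_inner_self_eq_norm_sq,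
      real_inner_self_eq_norm_sq]
    simp
  have hAsym (x y : H) : inner ℝ (A x) y = inner ℝ x (A y) := by
    simp only [hA, inner_sub_left, inner_sub_right, hsym, inner_smul_left, inner_smul_right]
    simp
  have hAF : ∀ x ∈ F, A x ∈ F := fun x hx => by
    rw [hA]
    exact F.sub_mem (hF _ (hF _ hx)) (F.smul_mem _ hx)
  have hAbound : ∀ x ∈ F, c₁ * c₂ * ‖x‖ ≤ ‖A x‖ := fun x hx => by
    have heq : A x = B (B x + d • x) - d • (B x + d • x) := by
      rw [hA, map_add, map_smul, smul_add, smul_smul, sq]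
      abel
    have h3 := h₁ _ (F.add_mem (hF x hx) (F.smul_mem d hx))
    rw [heq]
    calc c₁ * c₂ * ‖x‖ = c₁ * (c₂ * ‖x‖) := by ring
      _ ≤ c₁ * ‖B x + d • x‖ := by gcongr; exact h₂ x hx
      _ ≤ _ := h3
  let M : ℝ := ‖A‖ + 1
  have hM : 0 < M := by positivity
  have hnonneg : ∀ x ∈ F, 0 ≤ inner ℝ (A x) x := fun x hx => by
    rw [hform]
    have := pow_le_pow_left₀ (by positivity) (hBd x hx) 2
    rw [mul_pow] at this
    linarith
  have hquad : ∀ x ∈ F, ‖A x‖ ^ 2 ≤ M * inner ℝ (A x) x := fun x hx => by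
    -- Nonnegativity of the form at `x - M⁻¹ A x` yields `‖A x‖² ≤ M ⟪A x, x⟫`.
    have h4 := hnonneg (x - M⁻¹ • A x) (F.sub_mem hx (F.smul_mem _ (hAF x hx)))
    have h5 : inner ℝ (A (A x)) (A x) ≤ M * ‖A x‖ ^ 2 := by
      calc inner ℝ (A (A x)) (A x) ≤ ‖A (A x)‖ * ‖A x‖ := real_inner_le_norm _ _
        _ ≤ (‖A‖ * ‖A x‖) * ‖A x‖ := by gcongr; exact A.le_opNorm _
        _ ≤ (M * ‖A x‖) * ‖A x‖ := by gcongr; simp [M]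
        _ = _ := by ring
    have h6 : inner ℝ (A (x - M⁻¹ • A x)) (x - M⁻¹ • A x) =
        inner ℝ (A x) x - 2 * M⁻¹ * ‖A x‖ ^ 2 + M⁻¹ ^ 2 * inner ℝ (A (A x)) (A x) := by
      simp only [map_sub, map_smul, inner_sub_left, inner_sub_right, inner_smul_left,
        inner_smul_right, hAsym (A x) x, real_inner_self_eq_norm_sq]
      simp only [conj_trivial]
      ring
    rw [h6] at h4
    have h7 : M⁻¹ ^ 2 * inner ℝ (A (A x)) (A x) ≤ M⁻¹ * ‖A x‖ ^ 2 := by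
      calc M⁻¹ ^ 2 * inner ℝ (A (A x)) (A x) ≤ M⁻¹ ^ 2 * (M * ‖A x‖ ^ 2) := by gcongr
        _ = _ := by field_simp
    have h8 : M⁻¹ * ‖A x‖ ^ 2 ≤ inner ℝ (A x) x := by linarith
    rwa [inv_mul_le_iff₀ hM] at h8
  refine ⟨√(d ^ 2 + (c₁ * c₂) ^ 2 / M), Real.lt_sqrt_of_sq_lt (by simp; positivity), fun x hx => ?_⟩
  refine le_of_sq_le_sq ?_ (norm_nonneg _)
  rw [mul_pow, Real.sq_sqrt (by positivity), add_mul]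
  have h9 := (pow_le_pow_left₀ (by positivity) (hAbound x hx) 2).trans (hquad x hx)
  rw [hform, mul_pow, mul_comm M, ← div_le_iff₀ hM] at h9
  rw [div_mul_eq_mul_div]
  linarith

/-- If `B` is symmetric and `B - μ` is bounded below on an invariant subspace whenever `|μ| ≤ r`,
then `B` is bounded below by a number larger than `r`. -/
theorem exists_gt_bound_of_forall_bound {B : H →L[ℝ] H} (hB : (B : H →ₗ[ℝ] H).IsSymmetric)
    {F : Submodule ℝ H} (hF : ∀ x ∈ F, B x ∈ F) {r : ℝ} (hr : 0 ≤ r)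
    (h : ∀ μ, |μ| ≤ r → ∃ c > 0, ∀ x ∈ F, c * ‖x‖ ≤ ‖B x - μ • x‖) :
    ∃ d > r, ∀ x ∈ F, d * ‖x‖ ≤ ‖B x‖ := by
  have improve (d : ℝ) (hd : 0 ≤ d) (hdr : d ≤ r) (hBd : ∀ x ∈ F, d * ‖x‖ ≤ ‖B x‖) :
      ∃ d' > d, ∀ x ∈ F, d' * ‖x‖ ≤ ‖B x‖ := by
    obtain ⟨c₁, hc₁, h₁⟩ := h d (by rwa [abs_of_nonneg hd])
    obtain ⟨c₂, hc₂, h₂⟩ := h (-d) (by rwa [abs_neg, abs_of_nonneg hd])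
    exact exists_lt_bound_of_bound_sub_of_bound_add hB hF hd hBd hc₁ hc₂ h₁
      fun x hx => by simpa using h₂ x hx
  -- The lower bounds in `[0, r]` form a compact set. Its maximum can still be improved, and the
  -- improved bound must exceed `r`.
  let S : Set ℝ := {d | d ∈ Icc 0 r ∧ ∀ x ∈ F, d * ‖x‖ ≤ ‖B x‖}
  have hS : IsCompact S := by
    refine isCompact_Icc.of_isClosed_subset ?_ fun d hd => hd.1
    refine isClosed_Icc.inter ?_
    change IsClosed {d : ℝ | ∀ x ∈ F, d * ‖x‖ ≤ ‖B x‖}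
    simp only [ofPred_forall]
    exact isClosed_iInter fun x => isClosed_iInter fun _ =>
      isClosed_le (continuous_id.mul continuous_const) continuous_const
  obtain ⟨d, hdS, hmax⟩ := hS.exists_isGreatest ⟨0, ⟨le_rfl, hr⟩, by simp⟩
  obtain ⟨d', hd', hbound⟩ := improve d hdS.1.1 hdS.1.2 hdS.2
  refine ⟨d', ?_, hbound⟩
  by_contra hle
  exact absurd (hmax ⟨⟨hdS.1.1.trans hd'.le, not_lt.1 hle⟩, hbound⟩) (not_le.2 hd')

/-- The orthogonal projection onto `F` has kernel `Fᗮ`, so it is injective on `E`. -/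
theorem finrank_le_finrank_of_disjoint_orthogonal {E F : Submodule ℝ H} [FiniteDimensional ℝ F]
    (h : Disjoint E Fᗮ) : finrank ℝ E ≤ finrank ℝ F := by
  refine LinearMap.finrank_le_finrank_of_injective
    (f := (F.orthogonalProjectionOnto : H →ₗ[ℝ] F) ∘ₗ E.subtype) ?_
  rw [injective_iff_map_eq_zero]
  intro x hx
  exact Subtype.ext (Submodule.disjoint_def.1 h x x.2
    (Submodule.orthogonalProjectionOnto_eq_zero_iff.1 hx))

end SpectralSubspace

/-! ### Stability of spectral intervals under perturbation. -/

section SpectralInterval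

open Module Topology Filter

variable {H : Type*} [NormedAddCommGroup H] [InnerProductSpace ℝ H]

/-- `[α, β]` does not meet the essential spectrum of `T`, and `α` and `β` do not belong to the
spectrum of `T`. -/
structure IsSpectralInterval (T : H →L[ℝ] H) (α β : ℝ) : Prop where
  lt : α < β
  left_notMem : α ∉ spectrum ℝ T
  right_notMem : β ∉ spectrum ℝ T
  isFredholm : ∀ μ ∈ Icc α β, (T - μ • ContinuousLinearMap.id ℝ H).IsFredholm

theorem IsSpectralWindow.isSpectralInterval {T : H →L[ℝ] H} {ε : ℝ} (h : IsSpectralWindow T ε) :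
    IsSpectralInterval T (-ε) ε :=
  ⟨by linarith [h.pos], h.left_notMem, h.right_notMem, h.isFredholm⟩

theorem IsSpectralInterval.isSpectralWindow {T : H →L[ℝ] H} {ε : ℝ}
    (h : IsSpectralInterval T (-ε) ε) : IsSpectralWindow T ε :=
  ⟨by linarith [h.lt], h.right_notMem, h.left_notMem, h.isFredholm⟩

variable {T : H →L[ℝ] H}

theorem mem_spectrum_of_apply_eq_smul {μ : ℝ} {x : H} (hx : x ≠ 0) (h : T x = μ • x) :
    μ ∈ spectrum ℝ T := by
  intro hu
  obtain ⟨u, hu⟩ := hu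
  have h1 : (u : H →L[ℝ] H) x = 0 := by
    rw [hu, Algebra.algebraMap_eq_smul_one]
    simp [h]
  apply hx
  calc x = ((u⁻¹ : (H →L[ℝ] H)ˣ) : H →L[ℝ] H) ((u : H →L[ℝ] H) x) := by
        rw [← mul_apply_eq_comp, Units.inv_mul]; rfl
    _ = 0 := by rw [h1, map_zero]

theorem IsSpectralWindow.isSpectralInterval_of_lt {ε ε' : ℝ} (h : IsSpectralWindow T ε)
    (h' : IsSpectralWindow T ε') (hlt : ε < ε') : IsSpectralInterval T ε ε' :=
  ⟨hlt, h.right_notMem, h'.right_notMem, fun μ hμ =>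
    h'.isFredholm μ ⟨by linarith [h.pos, hμ.1, h'.pos], hμ.2⟩⟩

variable [CompleteSpace H]

theorem notMem_spectrum_of_isFredholm (hT : (T : H →ₗ[ℝ] H).IsSymmetric) {μ : ℝ}
    (h : (T - μ • ContinuousLinearMap.id ℝ H).IsFredholm) (hker : ∀ x, T x = μ • x → x = 0) :
    μ ∉ spectrum ℝ T := by
  have hu := h.isUnit (ContinuousLinearMap.isSymmetric_sub_smul_id hT μ) fun x hx =>
    hker x (by simpa [sub_eq_zero] using hx)
  rw [spectrum.notMem_iff, ← neg_sub, IsUnit.neg_iff, Algebra.algebraMap_eq_smul_one]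
  exact hu

/-- Eigenvalues of a symmetric operator are isolated from a point outside of the essential
spectrum. -/
theorem exists_forall_abs_sub_lt_eq_zero (hT : (T : H →ₗ[ℝ] H).IsSymmetric) {μ₀ : ℝ}
    (h : (T - μ₀ • ContinuousLinearMap.id ℝ H).IsFredholm) :
    ∃ c > 0, ∀ μ, |μ - μ₀| < c → μ ≠ μ₀ → ∀ x, T x = μ • x → x = 0 := by
  obtain ⟨c, hc, hbound⟩ := h.exists_bound_orthogonal_ker
  refine ⟨c, hc, fun μ hμ hne x hx => ?_⟩
  have hxo : x ∈ (T - μ₀ • ContinuousLinearMap.id ℝ H).kerᗮ := by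
    rw [← ContinuousLinearMap.eigenspace_eq_ker, Submodule.mem_orthogonal]
    intro y hy
    exact hT.orthogonalFamily_eigenspaces hne.symm ⟨y, hy⟩
      ⟨x, End.mem_eigenspace_iff.2 hx⟩
  have h1 := hbound x hxo
  have h2 : (T - μ₀ • ContinuousLinearMap.id ℝ H) x = (μ - μ₀) • x := by simp [hx, sub_smul]
  rw [h2, norm_smul, Real.norm_eq_abs] at h1
  by_contra hx0
  exact absurd (le_of_mul_le_mul_right h1 (norm_pos_iff.2 hx0)) (not_le.2 hμ)

/-- By compactness it suffices to look near one point `μ₀`, where the only possible eigenvalue is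
`μ₀` itself, of finite multiplicity. -/
theorem finiteDimensional_spectralSubspace (hT : (T : H →ₗ[ℝ] H).IsSymmetric) {α β : ℝ}
    (h : ∀ μ ∈ Icc α β, (T - μ • ContinuousLinearMap.id ℝ H).IsFredholm) :
    FiniteDimensional ℝ (spectralSubspace T (Icc α β)) := by
  refine (isCompact_Icc (a := α) (b := β)).induction_on
    (p := fun s => FiniteDimensional ℝ (spectralSubspace T s)) ?_ ?_ ?_ ?_
  · have h0 : spectralSubspace T ∅ = ⊥ := by simp [spectralSubspace]
    rw [h0]
    infer_instance
  · exact fun s t hst _ => Submodule.finiteDimensional_of_le (spectralSubspace_mono hst)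
  · intro s t _ _
    rw [spectralSubspace_union]
    infer_instance
  · intro μ₀ hμ₀
    obtain ⟨c, hc, hiso⟩ := exists_forall_abs_sub_lt_eq_zero hT (h μ₀ hμ₀)
    have := (h μ₀ hμ₀).finite_ker
    rw [← ContinuousLinearMap.eigenspace_eq_ker] at this
    refine ⟨Metric.ball μ₀ c, mem_nhdsWithin_of_mem_nhds (Metric.ball_mem_nhds _ hc),
      Submodule.finiteDimensional_of_le
        (S₂ := End.eigenspace (T : H →ₗ[ℝ] H) μ₀) (iSup₂_le fun μ hμ => ?_)⟩
    by_cases hne : μ = μ₀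
    · rw [hne]
    · intro x hx
      rw [hiso μ hμ hne x (End.mem_eigenspace_iff.1 hx)]
      exact Submodule.zero_mem _

/-- Off the eigenspaces, `T - m - μ` is bounded below for all `|μ| ≤ r`. With `exists_lt_bound` this
gives a gap `ρ < r < d` between the spectral subspace and its complement. -/
theorem IsSpectralInterval.exists_gt_bound_orthogonal (hT : (T : H →ₗ[ℝ] H).IsSymmetric) {m r : ℝ}
    (h : IsSpectralInterval T (m - r) (m + r)) :
    ∃ d > r, ∀ x ∈ (spectralSubspace T (Icc (m - r) (m + r)))ᗮ,
      d * ‖x‖ ≤ ‖(T - m • ContinuousLinearMap.id ℝ H) x‖ := by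
  have hr : 0 ≤ r := by linarith [h.lt]
  refine exists_gt_bound_of_forall_bound (ContinuousLinearMap.isSymmetric_sub_smul_id hT m)
    (fun x hx => ?_) hr fun μ hμ => ?_
  · have h1 : (T - m • ContinuousLinearMap.id ℝ H) x = T x - m • x := by simp
    rw [h1]
    exact Submodule.sub_mem _ (apply_mem_orthogonal_spectralSubspace hT hx)
      (Submodule.smul_mem _ _ hx)
  · have hmem : m + μ ∈ Icc (m - r) (m + r) := by
      rw [abs_le] at hμ
      constructor <;> linarith
    obtain ⟨c, hc, hbound⟩ := (h.isFredholm _ hmem).exists_bound_orthogonal_ker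
    refine ⟨c, hc, fun x hx => ?_⟩
    rw [← ContinuousLinearMap.eigenspace_eq_ker] at hbound
    have := hbound x (Submodule.orthogonal_le (eigenspace_le_spectralSubspace hmem) hx)
    simpa [add_smul, sub_sub] using this

theorem IsSpectralInterval.exists_lt_bound {m r : ℝ} (hT : (T : H →ₗ[ℝ] H).IsSymmetric)
    (h : IsSpectralInterval T (m - r) (m + r)) :
    ∃ ρ, 0 ≤ ρ ∧ ρ < r ∧ ∀ x ∈ spectralSubspace T (Icc (m - r) (m + r)),
      ‖(T - m • ContinuousLinearMap.id ℝ H) x‖ ≤ ρ * ‖x‖ := by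
  have hr : 0 < r := by linarith [h.lt]
  have hev : ∀ᶠ δ in 𝓝 (0 : ℝ), m - r + δ ∉ spectrum ℝ T ∧ m + r - δ ∉ spectrum ℝ T := by
    have hopen := (spectrum.isClosed (𝕜 := ℝ) T).isOpen_compl
    have h1 : Tendsto (fun δ : ℝ => m - r + δ) (𝓝 0) (𝓝 (m - r)) := by
      simpa using (continuous_const.add continuous_id).tendsto (0 : ℝ) (f := fun δ : ℝ => m - r + δ)
    have h2 : Tendsto (fun δ : ℝ => m + r - δ) (𝓝 0) (𝓝 (m + r)) := by
      simpa using (continuous_const.sub continuous_id).tendsto (0 : ℝ) (f := fun δ : ℝ => m + r - δ)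
    exact (h1.eventually (hopen.mem_nhds h.left_notMem)).and
      (h2.eventually (hopen.mem_nhds h.right_notMem))
  obtain ⟨η, hη, hball⟩ := Metric.eventually_nhds_iff.1 hev
  -- Eigenvalues inside keep distance `η` from the end points because the spectrum is closed; `r -
  -- η` may be negative.
  refine ⟨max 0 (r - η), le_max_left _ _, max_lt hr (by linarith), fun x hx =>
    norm_sub_smul_id_le_of_mem_spectralSubspace hT (le_max_left _ _) ?_ hx⟩
  rintro μ ⟨hμ₁, hμ₂⟩ ⟨y, hy, hTy⟩
  have hmem := mem_spectrum_of_apply_eq_smul hy hTy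
  refine le_max_of_le_right ?_
  by_contra! hlt
  rcases lt_abs.1 hlt with h1 | h1
  · refine (hball (y := m + r - μ) ?_).2 (by simpa using hmem)
    rw [Real.dist_eq, sub_zero, abs_lt]
    constructor <;> linarith
  · refine (hball (y := μ - (m - r)) ?_).1 (by simpa using hmem)
    rw [Real.dist_eq, sub_zero, abs_lt]
    constructor <;> linarith

theorem eventually_notMem_spectrum {μ : ℝ} (h : μ ∉ spectrum ℝ T) :
    ∀ᶠ S in 𝓝 T, μ ∉ spectrum ℝ S := by
  simp only [spectrum.notMem_iff] at h ⊢
  have hc : Continuous fun S : H →L[ℝ] H => algebraMap ℝ (H →L[ℝ] H) μ - S :=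
    continuous_const.sub continuous_id
  exact hc.continuousAt.eventually (Units.isOpen.mem_nhds h)

/-- Spectral intervals are stable under small symmetric perturbations, and so is the number of
eigenvalues in them. -/
theorem IsSpectralInterval.eventually {α β : ℝ} (hT : (T : H →ₗ[ℝ] H).IsSymmetric)
    (h : IsSpectralInterval T α β) :
    ∀ᶠ S : H →L[ℝ] H in 𝓝 T, (S : H →ₗ[ℝ] H).IsSymmetric → IsSpectralInterval S α β ∧
      finrank ℝ (spectralSubspace S (Icc α β)) = finrank ℝ (spectralSubspace T (Icc α β)) := by
  obtain ⟨m, r, rfl, rfl⟩ : ∃ m r, α = m - r ∧ β = m + r :=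
    ⟨(α + β) / 2, (β - α) / 2, by ring, by ring⟩
  obtain ⟨d, hd, hbelow⟩ := h.exists_gt_bound_orthogonal hT
  obtain ⟨ρ, hρ₀, hρ, habove⟩ := h.exists_lt_bound hT
  have hfinT := finiteDimensional_spectralSubspace hT h.isFredholm
  -- Half the smaller margin, so that `ρ + η < r < d - η` survives a perturbation of norm less than
  -- `η`.
  obtain ⟨η, hη, hηd, hηρ⟩ : ∃ η > 0, r < d - η ∧ ρ + η < r :=
    ⟨min (d - r) (r - ρ) / 2, by
      have : 0 < min (d - r) (r - ρ) := lt_min (by linarith) (by linarith)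
      linarith, by
      have : 0 < min (d - r) (r - ρ) := lt_min (by linarith) (by linarith)
      linarith [min_le_left (d - r) (r - ρ)], by
      have : 0 < min (d - r) (r - ρ) := lt_min (by linarith) (by linarith)
      linarith [min_le_right (d - r) (r - ρ)]⟩
  filter_upwards [eventually_notMem_spectrum h.left_notMem,
    eventually_notMem_spectrum h.right_notMem, Metric.ball_mem_nhds T hη] with S hS₁ hS₂ hST hS
  have hdiff (x : H) : ‖(S - T) x‖ ≤ η * ‖x‖ :=
    (S - T).le_of_opNorm_le (by rw [← dist_eq_norm]; exact (Metric.mem_ball.1 hST).le) x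
  have hsplit (x : H) : (S - m • ContinuousLinearMap.id ℝ H) x =
      (T - m • ContinuousLinearMap.id ℝ H) x + (S - T) x := by
    simp only [FunLike.coe_sub, Pi.sub_apply]
    abel
  have hbelowS : ∀ x ∈ (spectralSubspace T (Icc (m - r) (m + r)))ᗮ,
      (d - η) * ‖x‖ ≤ ‖(S - m • ContinuousLinearMap.id ℝ H) x‖ := fun x hx => by
    rw [hsplit]
    have h1 := norm_sub_le_norm_add ((T - m • ContinuousLinearMap.id ℝ H) x) ((S - T) x)
    linarith [hbelow x hx, hdiff x]
  have haboveS : ∀ x ∈ spectralSubspace T (Icc (m - r) (m + r)),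
      ‖(S - m • ContinuousLinearMap.id ℝ H) x‖ ≤ (ρ + η) * ‖x‖ := fun x hx => by
    rw [hsplit]
    have h1 := norm_add_le ((T - m • ContinuousLinearMap.id ℝ H) x) ((S - T) x)
    linarith [habove x hx, hdiff x]
  have hint : IsSpectralInterval S (m - r) (m + r) := by
    refine ⟨h.lt, hS₁, hS₂, fun μ hμ => ?_⟩
    have hμ' : |μ - m| ≤ r := abs_le.2 ⟨by linarith [hμ.1], by linarith [hμ.2]⟩
    refine ContinuousLinearMap.isFredholm_of_bound_orthogonal
      (ContinuousLinearMap.isSymmetric_sub_smul_id hS μ)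
      (spectralSubspace T (Icc (m - r) (m + r))) (c := d - η - |μ - m|) (by linarith)
      fun x hx => ?_
    have := ContinuousLinearMap.bound_sub_smul_id (hbelowS x hx) (μ - m)
    rwa [sub_sub S, ← add_smul, add_sub_cancel] at this
  refine ⟨hint, ?_⟩
  obtain ⟨d', hd', hbelow'⟩ := hint.exists_gt_bound_orthogonal hS
  have hfinS := finiteDimensional_spectralSubspace hS hint.isFredholm
  obtain ⟨ρ', -, hρ', habove'⟩ := hint.exists_lt_bound hS
  have disj {E F : Submodule ℝ H} {p q : ℝ} (hpq : p < q)
      (hE : ∀ x ∈ E, ‖(S - m • ContinuousLinearMap.id ℝ H) x‖ ≤ p * ‖x‖)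
      (hF : ∀ x ∈ F, q * ‖x‖ ≤ ‖(S - m • ContinuousLinearMap.id ℝ H) x‖) : Disjoint E F := by
    rw [Submodule.disjoint_def]
    intro x hxE hxF
    by_contra hx0
    exact absurd (le_of_mul_le_mul_right ((hF x hxF).trans (hE x hxE)) (norm_pos_iff.2 hx0))
      (not_le.2 hpq)
  -- `S - m` acts with factor below `r` on one operator's spectral subspace and above `r` on the
  -- complement of the other's; this works both ways.
  exact le_antisymm
    (finrank_le_finrank_of_disjoint_orthogonal (disj (by linarith) habove' hbelowS))
    (finrank_le_finrank_of_disjoint_orthogonal (disj (by linarith) haboveS hbelow'))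

/-- Below `c`, `T - μ` stays Fredholm; below `c'`, `0` is the only possible eigenvalue, so `T ∓ ε`
is injective and hence invertible. -/
theorem exists_isSpectralWindow (hT : (T : H →ₗ[ℝ] H).IsSymmetric) (h : T.IsFredholm) :
    ∃ ε, IsSpectralWindow T ε := by
  obtain ⟨c, hc, hbound⟩ := h.exists_bound_orthogonal_ker
  obtain ⟨c', hc', hiso⟩ := exists_forall_abs_sub_lt_eq_zero (μ₀ := 0) hT (by simpa using h)
  have := h.finite_ker
  have hfred (μ : ℝ) (hμ : |μ| < c) : (T - μ • ContinuousLinearMap.id ℝ H).IsFredholm :=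
    ContinuousLinearMap.isFredholm_of_bound_orthogonal
      (ContinuousLinearMap.isSymmetric_sub_smul_id hT μ) T.ker (sub_pos.2 hμ)
      fun x hx => ContinuousLinearMap.bound_sub_smul_id (hbound x hx) μ
  obtain ⟨ε, hε, hεc⟩ := exists_between (lt_min hc hc')
  obtain ⟨hεc, hεc'⟩ := lt_min_iff.1 hεc
  have hunit (μ : ℝ) (hμ : |μ| = ε) : μ ∉ spectrum ℝ T :=
    notMem_spectrum_of_isFredholm hT (hfred μ (by rwa [hμ]))
      (hiso μ (by rwa [sub_zero, hμ]) (by rintro rfl; simp at hμ; exact hε.ne hμ))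
  exact ⟨ε, hε, hunit ε (abs_of_pos hε), hunit (-ε) (by rw [abs_neg, abs_of_pos hε]),
    fun μ hμ => hfred μ ((abs_le.2 hμ).trans_lt hεc)⟩

/-- The interval `[0, ε']` splits at `ε`, which is not an eigenvalue. The extra term lives on an
interval with end points off the spectrum, hence is stable. -/
theorem IsSpectralWindow.eigenvalueCount_eq_add (hT : (T : H →ₗ[ℝ] H).IsSymmetric) {ε ε' : ℝ}
    (h : IsSpectralWindow T ε) (h' : IsSpectralWindow T ε') (hlt : ε < ε') :
    eigenvalueCount T ε' =
      eigenvalueCount T ε + finrank ℝ (spectralSubspace T (Icc ε ε')) := by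
  have hIoc : spectralSubspace T (Ioc ε ε') = spectralSubspace T (Icc ε ε') := by
    refine le_antisymm (spectralSubspace_mono Ioc_subset_Icc_self) (iSup₂_le fun μ hμ => ?_)
    rcases hμ.1.eq_or_lt with rfl | hεμ
    · intro x hx
      by_contra hx'
      refine h.right_notMem (mem_spectrum_of_apply_eq_smul (x := x) ?_ (End.mem_eigenspace_iff.1 hx))
      rintro rfl
      exact hx' (Submodule.zero_mem _)
    · exact eigenspace_le_spectralSubspace ⟨hεμ, hμ.2⟩
  have hfin₁ : FiniteDimensional ℝ (spectralSubspace T (Icc 0 ε)) :=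
    finiteDimensional_spectralSubspace hT fun μ hμ =>
      h.isFredholm μ ⟨by linarith [h.pos, hμ.1], hμ.2⟩
  have hfin₂ : FiniteDimensional ℝ (spectralSubspace T (Ioc ε ε')) := by
    rw [hIoc]
    exact finiteDimensional_spectralSubspace hT (h.isSpectralInterval_of_lt h' hlt).isFredholm
  have key := finrank_spectralSubspace_union hT
    (Set.disjoint_left.2 fun μ (hμ : μ ∈ Icc 0 ε) (hμ' : μ ∈ Ioc ε ε') => not_le.2 hμ'.1 hμ.2)
  rwa [Icc_union_Ioc_eq_Icc h.pos.le hlt.le, hIoc] at key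

/-- The eigenvalue counts in the spectral windows of a continuous family of self-adjoint Fredholm
operators form a local system. -/
theorem isIntegralLocalSystem_eigenvalueCount {Λ : Type*} [TopologicalSpace Λ] {L : Λ → H →L[ℝ] H}
    (hL : Continuous L) (hsym : ∀ l, (L l : H →ₗ[ℝ] H).IsSymmetric)
    (hfred : ∀ l, (L l).IsFredholm) :
    IsIntegralLocalSystem (fun ε => {l | IsSpectralWindow (L l) ε})
      (fun ε l => (eigenvalueCount (L l) ε : ℤ)) where
  isOpen ε := isOpen_iff_mem_nhds.2 fun l hl => by
    filter_upwards [hL.continuousAt.eventually (hl.isSpectralInterval.eventually (hsym l))]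
      with l' hl'
    exact (hl' (hsym l')).1.isSpectralWindow
  cover l := exists_isSpectralWindow (hsym l) (hfred l)
  continuousOn_sub := by
    have key {ε ε' : ℝ} (hlt : ε < ε') : ContinuousOn
        (fun l => (eigenvalueCount (L l) ε : ℤ) - (eigenvalueCount (L l) ε' : ℤ))
        ({l | IsSpectralWindow (L l) ε} ∩ {l | IsSpectralWindow (L l) ε'}) := by
      have hcongr : ContinuousOn
          (fun l => -(finrank ℝ (spectralSubspace (L l) (Icc ε ε')) : ℤ))
          ({l | IsSpectralWindow (L l) ε} ∩ {l | IsSpectralWindow (L l) ε'}) := by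
        intro l hl
        refine (continuousAt_const.congr (f := fun _ =>
          -(finrank ℝ (spectralSubspace (L l) (Icc ε ε')) : ℤ)) ?_).continuousWithinAt
        filter_upwards [hL.continuousAt.eventually
          ((hl.1.isSpectralInterval_of_lt hl.2 hlt).eventually (hsym l))] with l' hl'
        rw [(hl' (hsym l')).2]
      refine hcongr.congr fun l hl => ?_
      simp only
      rw [hl.1.eigenvalueCount_eq_add (hsym l) hl.2 hlt]
      push_cast
      ring
    intro ε ε'
    rcases lt_trichotomy ε ε' with hlt | rfl | hlt
    · exact key hlt
    · simpa using continuousOn_const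
    · have := (key hlt).neg
      rw [inter_comm] at this
      simpa [Pi.neg_def] using this

end SpectralInterval

/-! ### Hessians as a continuous family of symmetric operators. -/

section Hessian

variable {Λ : Type*} [TopologicalSpace Λ]
variable {H : Type*} [NormedAddCommGroup H] [InnerProductSpace ℝ H] [CompleteSpace H]

/-- The Riesz isomorphism of a real Hilbert space, as a continuous linear map. -/
noncomputable def rieszMap (H : Type*) [NormedAddCommGroup H] [InnerProductSpace ℝ H]
    [CompleteSpace H] : (H →L[ℝ] ℝ) →L[ℝ] H :=
  LinearMap.mkContinuous
    { toFun := (InnerProductSpace.toDual ℝ H).symm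
      map_add' := map_add _
      map_smul' := fun c x => by simp } 1 fun x => by simp

theorem inner_rieszMap (f : H →L[ℝ] ℝ) (x : H) : inner ℝ (rieszMap H f) x = f x :=
  InnerProductSpace.toDual_symm_apply

variable {U : Set H} {ψ : Λ → H → ℝ}

theorem IsFredholmC2Family.hessian_eq (h : IsFredholmC2Family U ψ) (l : Λ) :
    hessian ψ l = rieszMap H ∘L fderiv ℝ (fderiv ℝ (ψ l)) 0 := by
  have h1 : ContDiffAt ℝ 2 (ψ l) 0 := (h.contDiffOn l).contDiffAt (h.isOpen.mem_nhds h.zero_mem)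
  have h2 : DifferentiableAt ℝ (fderiv ℝ (ψ l)) 0 :=
    (h1.fderiv_right (m := 1) (by norm_num)).differentiableAt (by norm_num)
  exact ((rieszMap H).hasFDerivAt.comp (0 : H) h2.hasFDerivAt).fderiv

theorem IsFredholmC2Family.isSymmetric_hessian (h : IsFredholmC2Family U ψ) (l : Λ) :
    (hessian ψ l : H →ₗ[ℝ] H).IsSymmetric := fun x y => by
  have h1 : ContDiffAt ℝ 2 (ψ l) 0 := (h.contDiffOn l).contDiffAt (h.isOpen.mem_nhds h.zero_mem)
  have h2 : IsSymmSndFDerivAt ℝ (ψ l) 0 := h1.isSymmSndFDerivAt (by simp)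
  rw [h.hessian_eq, ContinuousLinearMap.coe_coe, real_inner_comm _ x]
  exact (inner_rieszMap _ _).trans ((h2 x y).trans (inner_rieszMap _ _).symm)

theorem IsFredholmC2Family.continuous_hessian (h : IsFredholmC2Family U ψ) :
    Continuous (hessian ψ) := by
  have h1 : Continuous fun l : Λ => fderiv ℝ (fderiv ℝ (ψ l)) 0 :=
    h.continuousOn_fderiv_fderiv.comp_continuous (f := fun l : Λ => (l, (0 : H)))
      (Continuous.prodMk_left 0) fun l => ⟨mem_univ l, h.zero_mem⟩
  rw [funext h.hessian_eq]
  exact continuous_const.clm_comp h1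

end Hessian

theorem proposition2p5 {Λ : Type*} [TopologicalSpace Λ] [ConnectedSpace Λ]
    (hfin : IsOfFiniteType Λ)
    (hH1 : CategoryTheory.Limits.IsZero (singularHomology 1 Λ ℚ))
    {H : Type*} [NormedAddCommGroup H] [InnerProductSpace ℝ H] [CompleteSpace H]
    [TopologicalSpace.SeparableSpace H]
    (U : Set H) (ψ : Λ → H → ℝ) (hψ : IsFredholmC2Family U ψ) :
    SatisfiesA (hessian ψ) :=
  satisfiesA_of_isIntegralLocalSystem hH1 (isIntegralLocalSystem_eigenvalueCount
    hψ.continuous_hessian hψ.isSymmetric_hessian hψ.isFredholm)
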